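/- Let $\Bbbk$ be an algebraically closed field and let $A$ be the Kronecker algebra over $\Bbbk$, i.e. the path algebra of the quiver with two vertices $1,2$ and two arrows $\alpha,\beta\colon 1\to 2$. Finite-dimensional $A$-modules are identified with finite-dimensional representations $M=(M(\alpha),M(\beta)\colon M(1)\rightrightarrows M(2))$. For $n\ge 1$ and $\lambda\in\Bbbk$ put $$P_n=\left(\begin{bmatrix}E_{n-1}\\ 0\end{bmatrix},\begin{bmatrix}0\\ E_{n-1}\end{bmatrix}\right),\quad I_n=\big([E_{n-1},0],[0,E_{n-1}]\big),\quad R_n(\lambda)=(E_n,J_n(\lambda)),\quad R_n(\infty)=(J_n(0),E_n),$$ where $E_n$ is the identity matrix of size $n$ and $J_n(\lambda)$ is the $n\times n$ Jordan cell with eigenvalue $\lambda$; put also $P_0=I_0=0$. Let $M$ be a finite-dimensional $A$-module, $d_1=\dim M(1)$, $d_2=\dim M(2)$, and let $F\colon\bigoplus_L L^{(d(L))}\to M$ be an isomorphism, where $L$ runs over all $P_n$, $R_n(\lambda)$, $I_n$ ($n\ge 1$, $\lambda\in\Bbbk\cup\{\infty\}$) and $d$ is a multiplicity function with finite support. Let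 $R_M$ and $I_M$ be the images under $F$ of the sum of the summands $R_n(\lambda)$ and of the sum of the summands $I_n$, respectively, so that $R_M\oplus I_M$ is a submodule of $M$. For modules $U$ and $N$ let $\mathsf{Tr}_N(U)$ be the sum of $\operatorname{Im} f$ over all $f\in\operatorname{Hom}_A(U,N)$. (1) If $g_1,\dots,g_b$ is a basis of $\operatorname{Hom}_A(I_{d_1},R_M\oplus I_M)$, then $$\sum_{i=1}^b\operatorname{Im} g_i=\mathsf{Tr}_{R_M\oplus I_M}(I_{d_1})=I_M .$$ (2) If $f_1,\dots,f_a$ is a basis of $\operatorname{Hom}_A(M,P_{d_2})$ and $g_1,\dots,g_b$ is a basis of $\operatorname{Hom}_A\big(I_{d_1},\bigcap_{i=1}^a\operatorname{Ker} f_i\big)$, then $$R_M\cong\Big(\bigcap_{i=1}^a\operatorname{Ker} f_i\Big)\Big/\Big(\sum_{i=1}^b\operatorname{Im} g_i\Big).$$ -/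

import Mathlib

universe u v w

/-- A finite-dimensional representation of the Kronecker quiver (two vertices `1`, `2` and two
arrows `α, β : 1 → 2`) over `k`, i.e. a finite-dimensional module over the Kronecker algebra. -/
structure KroneckerRep (k : Type u) [Field k] where
  V₁ : Type v
  V₂ : Type v
  [addCommGroup₁ : AddCommGroup V₁]
  [addCommGroup₂ : AddCommGroup V₂]
  [module₁ : Module k V₁]
  [module₂ : Module k V₂]
  [finite₁ : Module.Finite k V₁]
  [finite₂ : Module.Finite k V₂]
  α : V₁ →ₗ[k] V₂
  β : V₁ →ₗ[k] V₂

namespace KroneckerRep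

attribute [instance] addCommGroup₁ addCommGroup₂ module₁ module₂ finite₁ finite₂

variable {k : Type u} [Field k]

/-- The `k`-vector space of morphisms of representations `M → N`: pairs `(f₁, f₂)` of linear maps
with `N(α) f₁ = f₂ M(α)` and `N(β) f₁ = f₂ M(β)`. -/
def Hom (M : KroneckerRep.{u, v} k) (N : KroneckerRep.{u, w} k) :
    Submodule k ((M.V₁ →ₗ[k] N.V₁) × (M.V₂ →ₗ[k] N.V₂)) where
  carrier := {f | N.α ∘ₗ f.1 = f.2 ∘ₗ M.α ∧ N.β ∘ₗ f.1 = f.2 ∘ₗ M.β}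
  zero_mem' := by simp
  add_mem' := by
    rintro f g ⟨hf, hf'⟩ ⟨hg, hg'⟩
    exact ⟨by simp [LinearMap.comp_add, LinearMap.add_comp, hf, hg],
      by simp [LinearMap.comp_add, LinearMap.add_comp, hf', hg']⟩
  smul_mem' := by
    rintro c f ⟨hf, hf'⟩
    exact ⟨by simp [LinearMap.comp_smul, LinearMap.smul_comp, hf],
      by simp [LinearMap.comp_smul, LinearMap.smul_comp, hf']⟩

/-- Isomorphisms of representations. -/
structure Iso (M : KroneckerRep.{u, v} k) (N : KroneckerRep.{u, w} k) where
  e₁ : M.V₁ ≃ₗ[k] N.V₁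
  e₂ : M.V₂ ≃ₗ[k] N.V₂
  comm_α : ∀ x, N.α (e₁ x) = e₂ (M.α x)
  comm_β : ∀ x, N.β (e₁ x) = e₂ (M.β x)

/-- The morphism underlying an isomorphism. -/
def Iso.toHom {M : KroneckerRep.{u, v} k} {N : KroneckerRep.{u, w} k} (F : Iso M N) : Hom M N :=
  ⟨(F.e₁.toLinearMap, F.e₂.toLinearMap),
    LinearMap.ext F.comm_α, LinearMap.ext F.comm_β⟩

/-- Subrepresentations (submodules) of `M`. -/
@[ext]
structure SubRep (M : KroneckerRep.{u, v} k) where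
  S₁ : Submodule k M.V₁
  S₂ : Submodule k M.V₂
  α_mem : ∀ x ∈ S₁, M.α x ∈ S₂
  β_mem : ∀ x ∈ S₁, M.β x ∈ S₂

namespace SubRep

variable {M : KroneckerRep.{u, v} k}

/-- Subrepresentations are ordered by inclusion. -/
instance : PartialOrder (SubRep M) where
  le S T := S.S₁ ≤ T.S₁ ∧ S.S₂ ≤ T.S₂
  le_refl _ := ⟨le_rfl, le_rfl⟩
  le_trans _ _ _ h h' := ⟨h.1.trans h'.1, h.2.trans h'.2⟩
  le_antisymm _ _ h h' := SubRep.ext (le_antisymm h.1 h'.1) (le_antisymm h.2 h'.2)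

/-- The sum of a set of subrepresentations. -/
instance : SupSet (SubRep M) where
  sSup s :=
    { S₁ := ⨆ S ∈ s, S.S₁
      S₂ := ⨆ S ∈ s, S.S₂
      α_mem := fun _ hx => (iSup₂_le (a := Submodule.comap M.α (⨆ S ∈ s, S.S₂)) fun S hS y hy =>
        (le_iSup₂ (f := fun (S : SubRep M) (_ : S ∈ s) => S.S₂) S hS) (S.α_mem y hy)) hx
      β_mem := fun _ hx => (iSup₂_le (a := Submodule.comap M.β (⨆ S ∈ s, S.S₂)) fun S hS y hy =>
        (le_iSup₂ (f := fun (S : SubRep M) (_ : S ∈ s) => S.S₂) S hS) (S.β_mem y hy)) hx }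

/-- The intersection of a set of subrepresentations. -/
instance : InfSet (SubRep M) where
  sInf s :=
    { S₁ := ⨅ S ∈ s, S.S₁
      S₂ := ⨅ S ∈ s, S.S₂
      α_mem := fun x hx => by
        simp only [Submodule.mem_iInf] at hx ⊢
        exact fun S hS => S.α_mem x (hx S hS)
      β_mem := fun x hx => by
        simp only [Submodule.mem_iInf] at hx ⊢
        exact fun S hS => S.β_mem x (hx S hS) }

/-- The sum of two subrepresentations. -/
instance : Max (SubRep M) where
  max S T :=
    { S₁ := S.S₁ ⊔ T.S₁
      S₂ := S.S₂ ⊔ T.S₂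
      α_mem := fun _ hx => (sup_le (c := Submodule.comap M.α (S.S₂ ⊔ T.S₂))
        (fun y hy => Submodule.mem_sup_left (S.α_mem y hy))
        (fun y hy => Submodule.mem_sup_right (T.α_mem y hy))) hx
      β_mem := fun _ hx => (sup_le (c := Submodule.comap M.β (S.S₂ ⊔ T.S₂))
        (fun y hy => Submodule.mem_sup_left (S.β_mem y hy))
        (fun y hy => Submodule.mem_sup_right (T.β_mem y hy))) hx }

/-- A subrepresentation regarded as a representation. -/
def toRep (S : SubRep M) : KroneckerRep.{u, v} k where
  V₁ := S.S₁
  V₂ := S.S₂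
  α := M.α.restrict S.α_mem
  β := M.β.restrict S.β_mem

/-- The inclusion morphism of a subrepresentation. -/
def incl (S : SubRep M) : Hom S.toRep M :=
  ⟨(S.S₁.subtype, S.S₂.subtype), rfl, rfl⟩

/-- The quotient of a representation by a subrepresentation. -/
def quotient (S : SubRep M) : KroneckerRep.{u, v} k where
  V₁ := M.V₁ ⧸ S.S₁
  V₂ := M.V₂ ⧸ S.S₂
  α := S.S₁.mapQ S.S₂ M.α S.α_mem
  β := S.S₁.mapQ S.S₂ M.β S.β_mem

/-- The image of a subrepresentation under a morphism. -/
def map {N : KroneckerRep.{u, w} k} (f : Hom M N) (S : SubRep M) : SubRep N where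
  S₁ := S.S₁.map f.1.1
  S₂ := S.S₂.map f.1.2
  α_mem := by
    rintro _ ⟨x, hx, rfl⟩
    exact ⟨M.α x, S.α_mem x hx, (LinearMap.congr_fun f.2.1 x).symm⟩
  β_mem := by
    rintro _ ⟨x, hx, rfl⟩
    exact ⟨M.β x, S.β_mem x hx, (LinearMap.congr_fun f.2.2 x).symm⟩

end SubRep

/-- The image of a morphism. -/
def im {M : KroneckerRep.{u, v} k} {N : KroneckerRep.{u, w} k} (f : Hom M N) : SubRep N where
  S₁ := LinearMap.range f.1.1
  S₂ := LinearMap.range f.1.2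
  α_mem := by
    rintro _ ⟨x, rfl⟩
    exact ⟨M.α x, (LinearMap.congr_fun f.2.1 x).symm⟩
  β_mem := by
    rintro _ ⟨x, rfl⟩
    exact ⟨M.β x, (LinearMap.congr_fun f.2.2 x).symm⟩

/-- The kernel of a morphism. -/
def ker {M : KroneckerRep.{u, v} k} {N : KroneckerRep.{u, w} k} (f : Hom M N) : SubRep M where
  S₁ := LinearMap.ker f.1.1
  S₂ := LinearMap.ker f.1.2
  α_mem := fun x hx => by
    have h := LinearMap.congr_fun f.2.1 x
    simp only [LinearMap.comp_apply, LinearMap.mem_ker.1 hx, map_zero] at h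
    exact LinearMap.mem_ker.2 h.symm
  β_mem := fun x hx => by
    have h := LinearMap.congr_fun f.2.2 x
    simp only [LinearMap.comp_apply, LinearMap.mem_ker.1 hx, map_zero] at h
    exact LinearMap.mem_ker.2 h.symm

/-- The trace `Tr_M(U)` of `U` in `M`: the sum of the images of all morphisms `U → M`. -/
def trace (M : KroneckerRep.{u, v} k) (U : KroneckerRep.{u, w} k) : SubRep M :=
  ⨆ f : Hom U M, im f

/-- The direct sum of a finite family of representations. -/
def directSum {ι : Type w} [Finite ι] (X : ι → KroneckerRep.{u, v} k) :
    KroneckerRep.{u, max v w} k where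
  V₁ := ∀ i, (X i).V₁
  V₂ := ∀ i, (X i).V₂
  α := LinearMap.pi fun i => (X i).α ∘ₗ LinearMap.proj i
  β := LinearMap.pi fun i => (X i).β ∘ₗ LinearMap.proj i

/-- The partial direct sum of those summands whose index satisfies `p`, as a subrepresentation of
the whole direct sum. -/
def partialSum {ι : Type w} [Finite ι] (X : ι → KroneckerRep.{u, v} k) (p : ι → Prop) :
    SubRep (directSum X) where
  S₁ := Submodule.pi {i | ¬ p i} fun _ => ⊥
  S₂ := Submodule.pi {i | ¬ p i} fun _ => ⊥
  α_mem := fun x hx i hi => by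
    have h : x i = 0 := hx i hi
    change (X i).α (x i) = 0
    rw [h, map_zero]
  β_mem := fun x hx i hi => by
    have h : x i = 0 := hx i hi
    change (X i).β (x i) = 0
    rw [h, map_zero]

/-- The representation `(A, B)` given by a pair of `d₂ × d₁` matrices. -/
def ofMatrices {d₁ d₂ : ℕ} (A B : Matrix (Fin d₂) (Fin d₁) k) : KroneckerRep.{u, u} k where
  V₁ := Fin d₁ → k
  V₂ := Fin d₂ → k
  α := Matrix.toLin' A
  β := Matrix.toLin' B

variable (k)

/-- The preprojective indecomposable `Pₙ = ([E; 0], [0; E])` with `E` the identity matrix of size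
`n - 1`, for `n ≥ 1`; for `n = 0` this is the zero representation. -/
def P (n : ℕ) : KroneckerRep.{u, u} k :=
  ofMatrices (d₁ := n - 1) (d₂ := n)
    (Matrix.of fun i j => if (i : ℕ) = j then 1 else 0)
    (Matrix.of fun i j => if (i : ℕ) = j + 1 then 1 else 0)

/-- The preinjective indecomposable `Iₙ = ([E, 0], [0, E])` with `E` the identity matrix of size
`n - 1`, for `n ≥ 1`; for `n = 0` this is the zero representation. -/
def I (n : ℕ) : KroneckerRep.{u, u} k :=
  ofMatrices (d₁ := n) (d₂ := n - 1)
    (Matrix.of fun i j => if (j : ℕ) = i then 1 else 0)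
    (Matrix.of fun i j => if (j : ℕ) = i + 1 then 1 else 0)

variable {k}

/-- The Jordan cell `Jₙ(c)`: `c` on the diagonal, `1` on the superdiagonal. -/
def jordanCell (n : ℕ) (c : k) : Matrix (Fin n) (Fin n) k :=
  Matrix.of fun i j => if i = j then c else if (j : ℕ) = i + 1 then 1 else 0

/-- The regular indecomposable `Rₙ(c) = (Eₙ, Jₙ(c))`, for `c ∈ k`. -/
def R (n : ℕ) (c : k) : KroneckerRep.{u, u} k := ofMatrices 1 (jordanCell n c)

variable (k)

/-- The regular indecomposable `Rₙ(∞) = (Jₙ(0), Eₙ)`. -/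
def Rinfty (n : ℕ) : KroneckerRep.{u, u} k := ofMatrices (jordanCell n 0) 1

/-- Labels for the list of indecomposables `Pₙ`, `Rₙ(c)`, `Rₙ(∞)`, `Iₙ` (`n ≥ 1`, `c ∈ k`). -/
inductive Label : Type u
  | preprojective (n : ℕ+) : Label
  | regular (n : ℕ+) (c : k) : Label
  | regularInfty (n : ℕ+) : Label
  | preinjective (n : ℕ+) : Label

variable {k}

namespace Label

/-- The indecomposable representation with a given label. -/
def rep : Label k → KroneckerRep.{u, u} k
  | preprojective n => P k n
  | regular n c => R n c
  | regularInfty n => Rinfty k n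
  | preinjective n => I k n

/-- The label belongs to a regular indecomposable (with finite or infinite parameter). -/
def IsRegular : Label k → Prop
  | regular _ _ => True
  | regularInfty _ => True
  | _ => False

/-- The label belongs to a preinjective indecomposable. -/
def IsPreinjective : Label k → Prop
  | preinjective _ => True
  | _ => False

end Label

/-- The direct sum of the indecomposables `L`, each taken `d L` times. -/
def sumOfMult (d : Label k →₀ ℕ) : KroneckerRep.{u, u} k :=
  directSum fun x : (Σ L : d.support, Fin (d L)) => x.1.1.rep

/-- An indecomposable decomposition of `M`: multiplicities `d` and an isomorphism `F` from the
direct sum of the indecomposables `L` with multiplicities `d L` to `M`. -/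
structure Decomposition (M : KroneckerRep.{u, v} k) where
  d : Label k →₀ ℕ
  F : Iso (sumOfMult d) M

namespace Decomposition

variable {M : KroneckerRep.{u, v} k}

/-- The image under `F` of the sum of all summands whose label satisfies `p`. -/
def part (D : Decomposition M) (p : Label k → Prop) : SubRep M :=
  (partialSum (fun x : (Σ L : D.d.support, Fin (D.d L)) => x.1.1.rep) fun x => p x.1.1).map
    D.F.toHom

/-- The regular part `R_M`: the image under `F` of the sum of the regular summands. -/
def regularPart (D : Decomposition M) : SubRep M := D.part Label.IsRegular

/-- The preinjective part `I_M`: the image under `F` of the sum of the preinjective summands. -/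
def preinjectivePart (D : Decomposition M) : SubRep M := D.part Label.IsPreinjective

end Decomposition

end KroneckerRep

/-! Everything rests on two vanishing statements and two size bounds. A morphism from some `I n` to
a regular summand is zero (`hom_I_eq_zero`), and a morphism from a regular or preinjective summand
to some `P n` is zero (`hom_P_eq_zero`). Both follow by moving along the coordinates, using only
that one of the two maps is injective, respectively surjective. In the other direction, a
preinjective summand `I n` of `M` has `n ≤ d₁`, so it is a quotient of `I d₁`; a preprojective
summand `P n` has `n ≤ d₂`, so it embeds in `P d₂`. Hence morphisms to `P d₂` detect exactly the
preprojective components, and their common kernel is `R_M ⊕ I_M` (`iInf_ker_hom_P`). Inside it, the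
images of `I d₁` fill exactly `I_M` (`map_incl_trace_I`). Bases may replace all morphisms, since a
sum of images or an intersection of kernels depends only on the linear span. The quotient of `R_M ⊕
I_M` by `I_M` is then `R_M` (`nonempty_iso_quotient`). -/

namespace KroneckerRep

variable {k : Type u} [Field k]

universe v₁ v₂ v₃

/-- Composition of morphisms of representations. -/
def compHom {L : KroneckerRep.{u, v₁} k} {M : KroneckerRep.{u, v₂} k} {N : KroneckerRep.{u, v₃} k}
    (g : Hom M N) (f : Hom L M) : Hom L N :=
  ⟨(g.1.1 ∘ₗ f.1.1, g.1.2 ∘ₗ f.1.2), by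
    constructor <;> refine LinearMap.ext fun x => ?_
    · have hf := LinearMap.congr_fun f.2.1 x
      have hg := LinearMap.congr_fun g.2.1 (f.1.1 x)
      simp only [LinearMap.comp_apply] at hf hg ⊢
      rw [hg, hf]
    · have hf := LinearMap.congr_fun f.2.2 x
      have hg := LinearMap.congr_fun g.2.2 (f.1.1 x)
      simp only [LinearMap.comp_apply] at hf hg ⊢
      rw [hg, hf]⟩

/-- The morphism underlying the inverse of an isomorphism. -/
def Iso.invHom {M : KroneckerRep.{u, v} k} {N : KroneckerRep.{u, w} k} (F : Iso M N) : Hom N M :=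
  ⟨(F.e₁.symm.toLinearMap, F.e₂.symm.toLinearMap), by
    constructor <;> refine LinearMap.ext fun x => F.e₂.injective ?_
    · simp [← F.comm_α]
    · simp [← F.comm_β]⟩

/-- A morphism with image in a subrepresentation, as a morphism to that subrepresentation. -/
def codRestrictHom {L : KroneckerRep.{u, v₁} k} {M : KroneckerRep.{u, v₂} k} (S : SubRep M)
    (f : Hom L M) (h₁ : ∀ x, f.1.1 x ∈ S.S₁) (h₂ : ∀ x, f.1.2 x ∈ S.S₂) : Hom L S.toRep :=
  ⟨(f.1.1.codRestrict S.S₁ h₁, f.1.2.codRestrict S.S₂ h₂),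
    LinearMap.ext fun x => Subtype.ext (LinearMap.congr_fun f.2.1 x),
    LinearMap.ext fun x => Subtype.ext (LinearMap.congr_fun f.2.2 x)⟩

/-! ### Projections and inclusions of a finite direct sum -/

section DirectSum

variable {ι : Type w} [Finite ι] (X : ι → KroneckerRep.{u, v} k)

/-- The projection of a direct sum to a summand. -/
def projHom (i : ι) : Hom (directSum X) (X i) :=
  ⟨(LinearMap.proj i, LinearMap.proj i), rfl, rfl⟩

open Classical in
/-- The inclusion of a summand into a direct sum. -/
noncomputable def singleHom (i : ι) : Hom (X i) (directSum X) :=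
  ⟨(LinearMap.single k (fun i => (X i).V₁) i, LinearMap.single k (fun i => (X i).V₂) i), by
    constructor <;> refine LinearMap.ext fun x => funext fun j => ?_
    · change (X j).α (Pi.single (M := fun i => (X i).V₁) i x j) =
        Pi.single (M := fun i => (X i).V₂) i ((X i).α x) j
      by_cases h : j = i
      · subst h; simp
      · simp [h]
    · change (X j).β (Pi.single (M := fun i => (X i).V₁) i x j) =
        Pi.single (M := fun i => (X i).V₂) i ((X i).β x) j
      by_cases h : j = i
      · subst h; simp
      · simp [h]⟩

theorem singleHom_fst_same (i : ι) (x : (X i).V₁) : (singleHom X i).1.1 x i = x := by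
  classical
  exact Pi.single_eq_same (M := fun i => (X i).V₁) i x

theorem singleHom_fst_of_ne {i j : ι} (h : j ≠ i) (x : (X i).V₁) :
    (singleHom X i).1.1 x j = 0 := by
  classical
  exact Pi.single_eq_of_ne (M := fun i => (X i).V₁) h x

theorem singleHom_snd_same (i : ι) (x : (X i).V₂) : (singleHom X i).1.2 x i = x := by
  classical
  exact Pi.single_eq_same (M := fun i => (X i).V₂) i x

theorem singleHom_snd_of_ne {i j : ι} (h : j ≠ i) (x : (X i).V₂) :
    (singleHom X i).1.2 x j = 0 := by
  classical
  exact Pi.single_eq_of_ne (M := fun i => (X i).V₂) h x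

theorem sum_singleHom_fst [Fintype ι] (x : (directSum X).V₁) :
    ∑ i, (singleHom X i).1.1 (x i) = x := by
  classical
  exact LinearMap.sum_single_apply (fun i => (X i).V₁) x

theorem sum_singleHom_snd [Fintype ι] (x : (directSum X).V₂) :
    ∑ i, (singleHom X i).1.2 (x i) = x := by
  classical
  exact LinearMap.sum_single_apply (fun i => (X i).V₂) x

end DirectSum

/-! ### Sums of images and intersections of kernels over a basis -/

section Lattice

variable {M : KroneckerRep.{u, v} k}

theorem iSup_S₁ {ι : Sort*} (S : ι → SubRep M) : (⨆ i, S i).S₁ = ⨆ i, (S i).S₁ :=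
  iSup_range

theorem iSup_S₂ {ι : Sort*} (S : ι → SubRep M) : (⨆ i, S i).S₂ = ⨆ i, (S i).S₂ :=
  iSup_range

theorem iInf_S₁ {ι : Sort*} (S : ι → SubRep M) : (⨅ i, S i).S₁ = ⨅ i, (S i).S₁ :=
  iInf_range

theorem iInf_S₂ {ι : Sort*} (S : ι → SubRep M) : (⨅ i, S i).S₂ = ⨅ i, (S i).S₂ :=
  iInf_range

/-- The images of a basis of `Hom U M` sum up to the trace of `U` in `M`. -/
theorem iSup_im_basis {U : KroneckerRep.{u, w} k} {ι : Type*} (g : Module.Basis ι k (Hom U M)) :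
    ⨆ i, im (g i) = trace M U := by
  unfold trace
  apply SubRep.ext
  · rw [iSup_S₁, iSup_S₁]
    refine le_antisymm (iSup_le fun i => le_iSup (fun f : Hom U M => (im f).S₁) (g i))
      (iSup_le fun f => ?_)
    -- The morphisms whose image lies in a fixed subspace form a subspace of `Hom U M`, so it is
    -- enough to test a spanning set.
    induction g.mem_span f using Submodule.span_induction with
    | mem x hx => obtain ⟨i, rfl⟩ := hx; exact le_iSup (fun i => (im (g i)).S₁) i
    | zero => rintro _ ⟨x, rfl⟩; exact zero_mem _
    | add f f' _ _ h h' =>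
      rintro _ ⟨x, rfl⟩; exact add_mem (h ⟨x, rfl⟩) (h' ⟨x, rfl⟩)
    | smul c f _ h => rintro _ ⟨x, rfl⟩; exact Submodule.smul_mem _ c (h ⟨x, rfl⟩)
  · rw [iSup_S₂, iSup_S₂]
    refine le_antisymm (iSup_le fun i => le_iSup (fun f : Hom U M => (im f).S₂) (g i))
      (iSup_le fun f => ?_)
    induction g.mem_span f using Submodule.span_induction with
    | mem x hx => obtain ⟨i, rfl⟩ := hx; exact le_iSup (fun i => (im (g i)).S₂) i
    | zero => rintro _ ⟨x, rfl⟩; exact zero_mem _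
    | add f f' _ _ h h' =>
      rintro _ ⟨x, rfl⟩; exact add_mem (h ⟨x, rfl⟩) (h' ⟨x, rfl⟩)
    | smul c f _ h => rintro _ ⟨x, rfl⟩; exact Submodule.smul_mem _ c (h ⟨x, rfl⟩)

/-- The kernels of a basis of `Hom M N` have the same intersection as those of all morphisms. -/
theorem iInf_ker_basis {N : KroneckerRep.{u, w} k} {ι : Type*} (f : Module.Basis ι k (Hom M N)) :
    ⨅ i, ker (f i) = ⨅ h : Hom M N, ker h := by
  apply SubRep.ext
  · rw [iInf_S₁, iInf_S₁]
    refine le_antisymm (le_iInf fun h => ?_)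
      (le_iInf fun i => iInf_le (fun h : Hom M N => (ker h).S₁) (f i))
    intro x hx
    change h.1.1 x = 0
    induction f.mem_span h using Submodule.span_induction with
    | mem h hh => obtain ⟨i, rfl⟩ := hh; exact (Submodule.mem_iInf _).1 hx i
    | zero => rfl
    | add h h' _ _ e e' => exact (congrArg₂ (· + ·) e e').trans (add_zero 0)
    | smul c h _ e => exact (congrArg (c • ·) e).trans (smul_zero c)
  · rw [iInf_S₂, iInf_S₂]
    refine le_antisymm (le_iInf fun h => ?_)
      (le_iInf fun i => iInf_le (fun h : Hom M N => (ker h).S₂) (f i))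
    intro x hx
    change h.1.2 x = 0
    induction f.mem_span h using Submodule.span_induction with
    | mem h hh => obtain ⟨i, rfl⟩ := hh; exact (Submodule.mem_iInf _).1 hx i
    | zero => rfl
    | add h h' _ _ e e' => exact (congrArg₂ (· + ·) e e').trans (add_zero 0)
    | smul c h _ e => exact (congrArg (c • ·) e).trans (smul_zero c)

end Lattice

/-! ### Coordinates, vanishing of morphisms, and comparison of sizes -/

section Indecomposables

/-- Each matrix row has a single nonzero entry: on `I n`, `α` forgets the last coordinate and `β`
the first. On `P n` they append a zero at the end and at the start. Later arguments use only these
formulas. -/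
theorem I_α_apply (n : ℕ) (x : Fin n → k) (i : Fin (n - 1)) :
    (I k n).α x i = x ⟨i, by omega⟩ := by
  change Matrix.toLin' _ x i = _
  rw [Matrix.toLin'_apply, Matrix.mulVec, dotProduct,
    Finset.sum_eq_single (⟨i, by omega⟩ : Fin n)]
  · simp
  · intro j _ hj
    have : (j : ℕ) ≠ i := fun h => hj (Fin.ext h)
    simp [this]
  · simp

theorem I_β_apply (n : ℕ) (x : Fin n → k) (i : Fin (n - 1)) :
    (I k n).β x i = x ⟨i + 1, by omega⟩ := by
  change Matrix.toLin' _ x i = _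
  rw [Matrix.toLin'_apply, Matrix.mulVec, dotProduct,
    Finset.sum_eq_single (⟨i + 1, by omega⟩ : Fin n)]
  · simp
  · intro j _ hj
    have : (j : ℕ) ≠ i + 1 := fun h => hj (Fin.ext h)
    simp [this]
  · simp

theorem P_α_apply (n : ℕ) (x : Fin (n - 1) → k) (i : Fin n) :
    (P k n).α x i = if h : (i : ℕ) < n - 1 then x ⟨i, h⟩ else 0 := by
  change Matrix.toLin' _ x i = _
  rw [Matrix.toLin'_apply, Matrix.mulVec, dotProduct]
  split_ifs with h
  · rw [Finset.sum_eq_single (⟨i, h⟩ : Fin (n - 1))]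
    · simp
    · intro j _ hj
      have : (i : ℕ) ≠ j := fun h => hj (Fin.ext h.symm)
      simp [this]
    · simp
  · refine Finset.sum_eq_zero fun j _ => ?_
    have : (i : ℕ) ≠ j := by omega
    simp [this]

theorem P_β_apply (n : ℕ) (x : Fin (n - 1) → k) (i : Fin n) :
    (P k n).β x i = if h : 0 < (i : ℕ) then x ⟨i - 1, by omega⟩ else 0 := by
  change Matrix.toLin' _ x i = _
  rw [Matrix.toLin'_apply, Matrix.mulVec, dotProduct]
  split_ifs with h
  · rw [Finset.sum_eq_single (⟨i - 1, by omega⟩ : Fin (n - 1))]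
    · simp [Nat.sub_add_cancel h]
    · intro j _ hj
      have : (i : ℕ) ≠ j + 1 := fun h' => hj (Fin.ext (by simp [h']))
      simp [this]
    · simp
  · refine Finset.sum_eq_zero fun j _ => ?_
    have : (i : ℕ) ≠ j + 1 := by omega
    simp [this]

theorem R_α_bijective (n : ℕ) (c : k) : Function.Bijective (R n c).α := by
  have h : (R n c).α = LinearMap.id := Matrix.toLin'_one
  rw [h]
  exact Function.bijective_id

theorem Rinfty_β_bijective (n : ℕ) : Function.Bijective (Rinfty k n).β := by
  have h : (Rinfty k n).β = LinearMap.id := Matrix.toLin'_one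
  rw [h]
  exact Function.bijective_id

theorem I_α_surjective (n : ℕ) : Function.Surjective (I k n).α := by
  intro (y : Fin (n - 1) → k)
  refine ⟨(fun j : Fin n => if h : (j : ℕ) < n - 1 then y ⟨j, h⟩ else 0), funext fun i => ?_⟩
  rw [I_α_apply]
  simp

/-- The standard basis vectors of `Iₙ(1)`. -/
def basisVecI (k : Type u) [Field k] (n : ℕ) (i : Fin n) : (I k n).V₁ :=
  Pi.single (M := fun _ => k) i 1

/-- The coordinate functionals on `Pₙ(1)`. -/
def coordP₁ (k : Type u) [Field k] (n : ℕ) (i : Fin (n - 1)) : (P k n).V₁ →ₗ[k] k :=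
  LinearMap.proj (φ := fun _ => k) i

/-- The coordinate functionals on `Pₙ(2)`. -/
def coordP₂ (k : Type u) [Field k] (n : ℕ) (i : Fin n) : (P k n).V₂ →ₗ[k] k :=
  LinearMap.proj (φ := fun _ => k) i

theorem coordP₂_α (n : ℕ) (x : (P k n).V₁) (i : Fin n) :
    coordP₂ k n i ((P k n).α x) = if h : (i : ℕ) < n - 1 then coordP₁ k n ⟨i, h⟩ x else 0 :=
  P_α_apply n x i

theorem coordP₂_β (n : ℕ) (x : (P k n).V₁) (i : Fin n) :
    coordP₂ k n i ((P k n).β x) =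
      if h : 0 < (i : ℕ) then coordP₁ k n ⟨i - 1, by omega⟩ x else 0 :=
  P_β_apply n x i

theorem I_α_basisVecI_last (n : ℕ) (i : Fin n) (hi : (i : ℕ) + 1 = n) :
    (I k n).α (basisVecI k n i) = 0 := by
  refine funext fun j => (I_α_apply n _ j).trans ?_
  exact Pi.single_eq_of_ne (M := fun _ => k) (fun h => by
    have := congrArg Fin.val h
    simp only at this
    omega) 1

theorem I_β_basisVecI_zero (n : ℕ) (i : Fin n) (hi : (i : ℕ) = 0) :
    (I k n).β (basisVecI k n i) = 0 := by
  refine funext fun j => (I_β_apply n _ j).trans ?_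
  exact Pi.single_eq_of_ne (M := fun _ => k) (fun h => by
    have := congrArg Fin.val h
    simp only at this
    omega) 1

/-- The link between neighbours in the chain of basis vectors; with `α` killing the last and `β` the
first, it lets vanishing spread from either end. -/
theorem I_α_basisVecI_eq_β (n : ℕ) (i j : Fin n) (hij : (j : ℕ) = i + 1) :
    (I k n).α (basisVecI k n i) = (I k n).β (basisVecI k n j) := by
  refine funext fun l => (I_α_apply n _ l).trans (Eq.trans ?_ (I_β_apply n _ l).symm)
  change Pi.single (M := fun _ => k) i 1 _ = Pi.single (M := fun _ => k) j 1 _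
  simp [Pi.single_apply, Fin.ext_iff, hij]

/-- There are no nonzero morphisms from a preinjective `Iₙ` to a representation one of whose
two maps is injective. -/
theorem hom_I_eq_zero {n : ℕ} {N : KroneckerRep.{u, v} k}
    (hN : Function.Injective N.α ∨ Function.Injective N.β) (f : Hom (I k n) N) :
    (∀ x, f.1.1 x = 0) ∧ ∀ y, f.1.2 y = 0 := by
  have hα : ∀ x, N.α (f.1.1 x) = f.1.2 ((I k n).α x) := LinearMap.congr_fun f.2.1
  have hβ : ∀ x, N.β (f.1.1 x) = f.1.2 ((I k n).β x) := LinearMap.congr_fun f.2.2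
  have key : ∀ i : Fin n, f.1.1 (basisVecI k n i) = 0 := by
    rcases hN with hN | hN
    -- With `N.α` injective, start at the last basis vector and descend; `t` is the distance to the
    -- end.
    · have aux : ∀ t : ℕ, ∀ i : Fin n, (i : ℕ) + 1 + t = n →
          f.1.1 (basisVecI k n i) = 0 := by
        intro t
        induction t with
        | zero =>
          intro i hi
          refine (injective_iff_map_eq_zero N.α).1 hN _ ?_
          rw [hα, I_α_basisVecI_last n i hi, map_zero]
        | succ t ih =>
          intro i hi
          refine (injective_iff_map_eq_zero N.α).1 hN _ ?_
          rw [hα, I_α_basisVecI_eq_β n i ⟨i + 1, by omega⟩ rfl, ← hβ,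
            ih ⟨i + 1, by omega⟩ (by simp only; omega), map_zero]
      exact fun i => aux (n - 1 - i) i (by omega)
    -- With `N.β` injective, the same chain is climbed from the first basis vector.
    · rintro ⟨i, hi⟩
      induction i with
      | zero =>
        refine (injective_iff_map_eq_zero N.β).1 hN _ ?_
        rw [hβ, I_β_basisVecI_zero n ⟨0, hi⟩ rfl, map_zero]
      | succ i ih =>
        refine (injective_iff_map_eq_zero N.β).1 hN _ ?_
        rw [hβ, ← I_α_basisVecI_eq_β n ⟨i, by omega⟩ ⟨i + 1, hi⟩ rfl, ← hα,
          ih (by omega), map_zero]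
  have h₁ : f.1.1 = 0 := by
    refine LinearMap.pi_ext' (φ := fun _ : Fin n => k) fun i => LinearMap.ext_ring ?_
    exact key i
  refine ⟨fun x => by rw [h₁]; rfl, fun y => ?_⟩
  obtain ⟨x, rfl⟩ := I_α_surjective n y
  rw [← hα, h₁]
  exact map_zero _

/-- There are no nonzero morphisms to a preprojective `Pₙ` from a representation one of whose
two maps is surjective. -/
theorem hom_P_eq_zero {n : ℕ} {N : KroneckerRep.{u, v} k}
    (hN : Function.Surjective N.α ∨ Function.Surjective N.β) (f : Hom N (P k n)) :
    (∀ x, f.1.1 x = 0) ∧ ∀ y, f.1.2 y = 0 := by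
  have hα : ∀ x, (P k n).α (f.1.1 x) = f.1.2 (N.α x) := LinearMap.congr_fun f.2.1
  have hβ : ∀ x, (P k n).β (f.1.1 x) = f.1.2 (N.β x) := LinearMap.congr_fun f.2.2
  -- Both sides are the `i`-th coordinate of `f.1.1 x`. This is the dual chain, linking coordinate
  -- functionals instead of basis vectors.
  have shift : ∀ x (i j : Fin n), (j : ℕ) = i + 1 →
      coordP₂ k n i (f.1.2 (N.α x)) = coordP₂ k n j (f.1.2 (N.β x)) := by
    intro x i j hij
    rw [← hα, ← hβ, coordP₂_α, coordP₂_β, dif_pos (by omega), dif_pos (by omega)]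
    congr 2
    exact Fin.ext (by simp [hij])
  have key : ∀ (i : Fin n) (y : N.V₂), coordP₂ k n i (f.1.2 y) = 0 := by
    rcases hN with hN | hN
    -- The last coordinate vanishes on the image of `α` in `P n`; surjectivity of `N.α` makes it
    -- vanish on the whole image of `f.1.2`, and `shift` carries this downwards.
    · have aux : ∀ t : ℕ, ∀ i : Fin n, (i : ℕ) + 1 + t = n →
          ∀ y : N.V₂, coordP₂ k n i (f.1.2 y) = 0 := by
        intro t
        induction t with
        | zero =>
          intro i hi y
          obtain ⟨x, rfl⟩ := hN y
          rw [← hα, coordP₂_α, dif_neg (by omega)]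
        | succ t ih =>
          intro i hi y
          obtain ⟨x, rfl⟩ := hN y
          rw [shift x i ⟨i + 1, by omega⟩ rfl]
          exact ih ⟨i + 1, by omega⟩ (by simp only; omega) _
      exact fun i => aux (n - 1 - i) i (by omega)
    · rintro ⟨i, hi⟩
      induction i with
      | zero =>
        intro y
        obtain ⟨x, rfl⟩ := hN y
        rw [← hβ, coordP₂_β, dif_neg (by simp)]
      | succ i ih =>
        intro y
        obtain ⟨x, rfl⟩ := hN y
        rw [← shift x ⟨i, by omega⟩ ⟨i + 1, hi⟩ rfl]
        exact ih (by omega) _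
  refine ⟨fun x => funext fun (i : Fin (n - 1)) => ?_, fun y => funext fun i => key i y⟩
  -- Since `α` on `P n` preserves the first `n - 1` coordinates, vanishing at vertex 2 forces
  -- vanishing at vertex 1.
  have h := key ⟨i, by omega⟩ (N.α x)
  rw [← hα, coordP₂_α, dif_pos i.2] at h
  exact h

/-- `Iₘ` surjects onto `Iₙ` for `n ≤ m`. -/
theorem exists_surjective_hom_I {m n : ℕ} (h : n ≤ m) :
    ∃ f : Hom (I k m) (I k n), Function.Surjective f.1.1 ∧ Function.Surjective f.1.2 := by
  -- Truncation to the first coordinates at both vertices commutes with both shifts.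
  refine ⟨⟨(LinearMap.funLeft k k (Fin.castLE h),
    LinearMap.funLeft k k (Fin.castLE (Nat.sub_le_sub_right h 1))), ?_, ?_⟩, ?_, ?_⟩
  · refine LinearMap.ext fun x => funext fun i => ?_
    exact (I_α_apply n _ i).trans (I_α_apply m x (Fin.castLE (Nat.sub_le_sub_right h 1) i)).symm
  · refine LinearMap.ext fun x => funext fun i => ?_
    exact (I_β_apply n _ i).trans (I_β_apply m x (Fin.castLE (Nat.sub_le_sub_right h 1) i)).symm
  · exact LinearMap.funLeft_surjective_of_injective k k _ (Fin.castLE_injective _)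
  · exact LinearMap.funLeft_surjective_of_injective k k _ (Fin.castLE_injective _)

/-- Extension of vectors by zero. -/
def extendZero (k : Type u) [Field k] (n m : ℕ) : (Fin n → k) →ₗ[k] (Fin m → k) where
  toFun y i := if h : (i : ℕ) < n then y ⟨i, h⟩ else 0
  map_add' x y := by
    ext i
    by_cases h : (i : ℕ) < n <;> simp [h]
  map_smul' c x := by
    ext i
    by_cases h : (i : ℕ) < n <;> simp [h]

theorem extendZero_apply (n m : ℕ) (y : Fin n → k) (i : Fin m) :
    extendZero k n m y i = if h : (i : ℕ) < n then y ⟨i, h⟩ else 0 := rfl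

theorem extendZero_injective {n m : ℕ} (h : n ≤ m) : Function.Injective (extendZero k n m) := by
  intro x y hxy
  ext i
  have := congrFun hxy (Fin.castLE h i)
  simpa [extendZero_apply] using this

/-- `Pₙ` embeds into `Pₘ` for `n ≤ m`. -/
theorem exists_injective_hom_P {m n : ℕ} (h : n ≤ m) :
    ∃ f : Hom (P k n) (P k m), Function.Injective f.1.1 ∧ Function.Injective f.1.2 := by
  refine ⟨⟨(extendZero k (n - 1) (m - 1), extendZero k n m), ?_, ?_⟩,
    extendZero_injective (Nat.sub_le_sub_right h 1), extendZero_injective h⟩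
  · refine LinearMap.ext fun (x : Fin (n - 1) → k) => funext fun (i : Fin m) => ?_
    refine (P_α_apply m (extendZero k (n - 1) (m - 1) x) i).trans ?_
    refine Eq.trans ?_ (extendZero_apply n m ((P k n).α x) i).symm
    -- Only the inner bound matters because `n - 1 ≤ m - 1`; what remains is comparing index ranges.
    change (if _ : (i : ℕ) < m - 1 then (if h' : (i : ℕ) < n - 1 then x ⟨i, h'⟩ else 0) else 0) = _
    by_cases h : (i : ℕ) < n
    · refine Eq.trans ?_ ((dif_pos h).trans (P_α_apply n x ⟨i, h⟩)).symm
      change _ = if h' : (i : ℕ) < n - 1 then x ⟨i, h'⟩ else 0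
      split_ifs <;> first | rfl | omega
    · refine Eq.trans ?_ (dif_neg h).symm
      split_ifs <;> first | rfl | omega
  · refine LinearMap.ext fun (x : Fin (n - 1) → k) => funext fun (i : Fin m) => ?_
    refine (P_β_apply m (extendZero k (n - 1) (m - 1) x) i).trans ?_
    refine Eq.trans ?_ (extendZero_apply n m ((P k n).β x) i).symm
    change (if _ : 0 < (i : ℕ) then (if h' : (i : ℕ) - 1 < n - 1 then x ⟨i - 1, h'⟩ else 0) else 0) = _
    by_cases h : (i : ℕ) < n
    · refine Eq.trans ?_ ((dif_pos h).trans (P_β_apply n x ⟨i, h⟩)).symm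
      change _ = if h' : 0 < (i : ℕ) then x ⟨i - 1, by omega⟩ else 0
      split_ifs <;> first | rfl | omega
    · refine Eq.trans ?_ (dif_neg h).symm
      split_ifs <;> first | rfl | omega

end Indecomposables

/-! ### What the three families contribute to the argument -/

namespace Label

/-- One of the two maps is the identity: `α` for a finite parameter, `β` at infinity. The Jordan
cell plays no role. -/
theorem IsRegular.injective {L : Label k} (h : L.IsRegular) :
    Function.Injective L.rep.α ∨ Function.Injective L.rep.β := by
  cases L with
  | regular n c => exact Or.inl (R_α_bijective n c).1
  | regularInfty n => exact Or.inr (Rinfty_β_bijective n).1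
  | _ => exact h.elim

theorem surjective_of_isRegular_or_isPreinjective {L : Label k}
    (h : L.IsRegular ∨ L.IsPreinjective) :
    Function.Surjective L.rep.α ∨ Function.Surjective L.rep.β := by
  cases L with
  | regular n c => exact Or.inl (R_α_bijective n c).2
  | regularInfty n => exact Or.inr (Rinfty_β_bijective n).2
  | preinjective n => exact Or.inl (I_α_surjective n)
  | preprojective n => exact (h.elim id id).elim

/-- The index of `I n` is its dimension at vertex 1, which is why `d₁` is the right size for the
test module; for `P n` it is the dimension at vertex 2, whence `d₂`. -/
theorem exists_surjective_hom_rep {L : Label k} (h : L.IsPreinjective) {m : ℕ}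
    (hm : Module.finrank k L.rep.V₁ ≤ m) :
    ∃ f : Hom (I k m) L.rep, Function.Surjective f.1.1 ∧ Function.Surjective f.1.2 := by
  cases L with
  | preinjective n =>
    have e : Module.finrank k (I k n).V₁ = n := Module.finrank_fin_fun k
    exact exists_surjective_hom_I (e.symm.le.trans hm)
  | _ => exact h.elim

theorem exists_injective_hom_rep {L : Label k} (h : ¬(L.IsRegular ∨ L.IsPreinjective)) {m : ℕ}
    (hm : Module.finrank k L.rep.V₂ ≤ m) :
    ∃ f : Hom L.rep (P k m), Function.Injective f.1.1 ∧ Function.Injective f.1.2 := by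
  cases L with
  | preprojective n =>
    have e : Module.finrank k (P k n).V₂ = n := Module.finrank_fin_fun k
    exact exists_injective_hom_P (e.symm.le.trans hm)
  | preinjective n => exact (h (Or.inr trivial)).elim
  | _ => exact (h (Or.inl trivial)).elim

end Label

/-! ### Parts of a decomposition, the common kernel and the trace -/

namespace Decomposition

variable {M : KroneckerRep.{u, v} k} (D : Decomposition M)

/-- The index set of the summands of a decomposition. -/
abbrev Index : Type u := Σ L : D.d.support, Fin (D.d L)

/-- The projection of `M` to a summand of its decomposition. -/
def proj (i : D.Index) : Hom M i.1.1.rep :=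
  compHom (projHom (fun x : D.Index => x.1.1.rep) i) D.F.invHom

/-- The embedding of a summand of the decomposition of `M`. -/
noncomputable def single (i : D.Index) : Hom i.1.1.rep M :=
  compHom D.F.toHom (singleHom (fun x : D.Index => x.1.1.rep) i)

theorem sum_single_proj_fst (x : M.V₁) : ∑ i, (D.single i).1.1 ((D.proj i).1.1 x) = x := by
  have h := congrArg D.F.e₁ (sum_singleHom_fst (fun x : D.Index => x.1.1.rep) (D.F.e₁.symm x))
  exact (map_sum D.F.e₁ _ _).symm.trans (h.trans (D.F.e₁.apply_symm_apply x))

theorem sum_single_proj_snd (x : M.V₂) : ∑ i, (D.single i).1.2 ((D.proj i).1.2 x) = x := by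
  have h := congrArg D.F.e₂ (sum_singleHom_snd (fun x : D.Index => x.1.1.rep) (D.F.e₂.symm x))
  exact (map_sum D.F.e₂ _ _).symm.trans (h.trans (D.F.e₂.apply_symm_apply x))

theorem proj_single_self_fst (i : D.Index) (x : i.1.1.rep.V₁) :
    (D.proj i).1.1 ((D.single i).1.1 x) = x := by
  change D.F.e₁.symm (D.F.e₁ _) i = x
  rw [LinearEquiv.symm_apply_apply]
  exact singleHom_fst_same (fun x : D.Index => x.1.1.rep) i x

theorem proj_single_self_snd (i : D.Index) (x : i.1.1.rep.V₂) :
    (D.proj i).1.2 ((D.single i).1.2 x) = x := by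
  change D.F.e₂.symm (D.F.e₂ _) i = x
  rw [LinearEquiv.symm_apply_apply]
  exact singleHom_snd_same (fun x : D.Index => x.1.1.rep) i x

theorem proj_single_of_ne_fst {i j : D.Index} (h : j ≠ i) (x : i.1.1.rep.V₁) :
    (D.proj j).1.1 ((D.single i).1.1 x) = 0 := by
  change D.F.e₁.symm (D.F.e₁ _) j = 0
  rw [LinearEquiv.symm_apply_apply]
  exact singleHom_fst_of_ne (fun x : D.Index => x.1.1.rep) h x

theorem proj_single_of_ne_snd {i j : D.Index} (h : j ≠ i) (x : i.1.1.rep.V₂) :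
    (D.proj j).1.2 ((D.single i).1.2 x) = 0 := by
  change D.F.e₂.symm (D.F.e₂ _) j = 0
  rw [LinearEquiv.symm_apply_apply]
  exact singleHom_snd_of_ne (fun x : D.Index => x.1.1.rep) h x

/-- Turns membership in a part into a condition on components, so that `R_M ⊕ I_M` and `I_M` can be
tested one summand at a time. -/
theorem mem_part_S₁ (p : Label k → Prop) (x : M.V₁) :
    x ∈ (D.part p).S₁ ↔ ∀ i : D.Index, ¬p i.1.1 → (D.proj i).1.1 x = 0 := by
  constructor
  · rintro ⟨y, hy, rfl⟩ i hi
    change D.F.e₁.symm (D.F.e₁ y) i = 0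
    rw [LinearEquiv.symm_apply_apply]
    exact hy i hi
  · exact fun h => ⟨D.F.e₁.symm x, h, D.F.e₁.apply_symm_apply x⟩

theorem mem_part_S₂ (p : Label k → Prop) (x : M.V₂) :
    x ∈ (D.part p).S₂ ↔ ∀ i : D.Index, ¬p i.1.1 → (D.proj i).1.2 x = 0 := by
  constructor
  · rintro ⟨y, hy, rfl⟩ i hi
    change D.F.e₂.symm (D.F.e₂ y) i = 0
    rw [LinearEquiv.symm_apply_apply]
    exact hy i hi
  · exact fun h => ⟨D.F.e₂.symm x, h, D.F.e₂.apply_symm_apply x⟩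

theorem single_mem_part_S₁ {p : Label k → Prop} {i : D.Index} (hi : p i.1.1)
    (x : i.1.1.rep.V₁) : (D.single i).1.1 x ∈ (D.part p).S₁ :=
  (D.mem_part_S₁ p _).2 fun j hj => D.proj_single_of_ne_fst (by rintro rfl; exact hj hi) x

theorem single_mem_part_S₂ {p : Label k → Prop} {i : D.Index} (hi : p i.1.1)
    (x : i.1.1.rep.V₂) : (D.single i).1.2 x ∈ (D.part p).S₂ :=
  (D.mem_part_S₂ p _).2 fun j hj => D.proj_single_of_ne_snd (by rintro rfl; exact hj hi) x

theorem part_sup_part (p q : Label k → Prop) :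
    D.part p ⊔ D.part q = D.part fun L => p L ∨ q L := by
  apply SubRep.ext
  · change (D.part p).S₁ ⊔ (D.part q).S₁ = _
    apply le_antisymm
    · refine sup_le (fun x hx => ?_) (fun x hx => ?_) <;> rw [mem_part_S₁] at hx ⊢
      · exact fun i hi => hx i fun h => hi (Or.inl h)
      · exact fun i hi => hx i fun h => hi (Or.inr h)
    · intro x hx
      rw [mem_part_S₁] at hx
      rw [← D.sum_single_proj_fst x]
      refine sum_mem fun i _ => ?_
      by_cases hp : p i.1.1
      · exact Submodule.mem_sup_left (D.single_mem_part_S₁ hp _)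
      by_cases hq : q i.1.1
      · exact Submodule.mem_sup_right (D.single_mem_part_S₁ hq _)
      rw [hx i (not_or.2 ⟨hp, hq⟩), map_zero]
      exact zero_mem _
  · change (D.part p).S₂ ⊔ (D.part q).S₂ = _
    apply le_antisymm
    · refine sup_le (fun x hx => ?_) (fun x hx => ?_) <;> rw [mem_part_S₂] at hx ⊢
      · exact fun i hi => hx i fun h => hi (Or.inl h)
      · exact fun i hi => hx i fun h => hi (Or.inr h)
    · intro x hx
      rw [mem_part_S₂] at hx
      rw [← D.sum_single_proj_snd x]
      refine sum_mem fun i _ => ?_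
      by_cases hp : p i.1.1
      · exact Submodule.mem_sup_left (D.single_mem_part_S₂ hp _)
      by_cases hq : q i.1.1
      · exact Submodule.mem_sup_right (D.single_mem_part_S₂ hq _)
      rw [hx i (not_or.2 ⟨hp, hq⟩), map_zero]
      exact zero_mem _

theorem disjoint_part_S₁ {p q : Label k → Prop} (h : ∀ L, p L → ¬q L) :
    Disjoint (D.part p).S₁ (D.part q).S₁ := by
  rw [Submodule.disjoint_def]
  intro x hp hq
  rw [mem_part_S₁] at hp hq
  rw [← D.sum_single_proj_fst x]
  refine Finset.sum_eq_zero fun i _ => ?_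
  by_cases hi : p i.1.1
  · rw [hq i (h _ hi), map_zero]
  · rw [hp i hi, map_zero]

theorem disjoint_part_S₂ {p q : Label k → Prop} (h : ∀ L, p L → ¬q L) :
    Disjoint (D.part p).S₂ (D.part q).S₂ := by
  rw [Submodule.disjoint_def]
  intro x hp hq
  rw [mem_part_S₂] at hp hq
  rw [← D.sum_single_proj_snd x]
  refine Finset.sum_eq_zero fun i _ => ?_
  by_cases hi : p i.1.1
  · rw [hq i (h _ hi), map_zero]
  · rw [hp i hi, map_zero]

/-- A summand embeds with a left inverse; this supplies the size bounds on its index. -/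
theorem finrank_rep_V₁_le (i : D.Index) :
    Module.finrank k i.1.1.rep.V₁ ≤ Module.finrank k M.V₁ :=
  LinearMap.finrank_le_finrank_of_injective (f := (D.single i).1.1)
    (Function.LeftInverse.injective (D.proj_single_self_fst i))

theorem finrank_rep_V₂_le (i : D.Index) :
    Module.finrank k i.1.1.rep.V₂ ≤ Module.finrank k M.V₂ :=
  LinearMap.finrank_le_finrank_of_injective (f := (D.single i).1.2)
    (Function.LeftInverse.injective (D.proj_single_self_snd i))

theorem regularPart_sup_preinjectivePart :
    D.regularPart ⊔ D.preinjectivePart = D.part fun L => L.IsRegular ∨ L.IsPreinjective :=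
  D.part_sup_part _ _

/-- The morphisms `M → Pₘ`, `m = dim M(2)`, have `R_M ⊕ I_M` as their common kernel. -/
theorem iInf_ker_hom_P {m : ℕ} (hm : Module.finrank k M.V₂ = m) :
    ⨅ h : Hom M (P k m), ker h = D.regularPart ⊔ D.preinjectivePart := by
  rw [regularPart_sup_preinjectivePart]
  apply SubRep.ext
  · rw [iInf_S₁]
    ext x
    rw [mem_part_S₁, Submodule.mem_iInf]
    constructor
    · intro hx i hi
      -- Projecting to a preprojective summand and embedding it in `P k m` gives a test morphism
      -- that detects this component.
      obtain ⟨j, hj, -⟩ := Label.exists_injective_hom_rep hi (hm ▸ D.finrank_rep_V₂_le i)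
      exact (injective_iff_map_eq_zero j.1.1).1 hj _ (hx (compHom j (D.proj i)))
    · intro hx h
      change h.1.1 x = 0
      rw [← D.sum_single_proj_fst x, map_sum]
      refine Finset.sum_eq_zero fun i _ => ?_
      by_cases hi : i.1.1.IsRegular ∨ i.1.1.IsPreinjective
      · exact (hom_P_eq_zero (Label.surjective_of_isRegular_or_isPreinjective hi)
          (compHom h (D.single i))).1 _
      · rw [hx i hi, map_zero, map_zero]
  · rw [iInf_S₂]
    ext x
    rw [mem_part_S₂, Submodule.mem_iInf]
    constructor
    · intro hx i hi
      obtain ⟨j, -, hj⟩ := Label.exists_injective_hom_rep hi (hm ▸ D.finrank_rep_V₂_le i)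
      exact (injective_iff_map_eq_zero j.1.2).1 hj _ (hx (compHom j (D.proj i)))
    · intro hx h
      change h.1.2 x = 0
      rw [← D.sum_single_proj_snd x, map_sum]
      refine Finset.sum_eq_zero fun i _ => ?_
      by_cases hi : i.1.1.IsRegular ∨ i.1.1.IsPreinjective
      · exact (hom_P_eq_zero (Label.surjective_of_isRegular_or_isPreinjective hi)
          (compHom h (D.single i))).2 _
      · rw [hx i hi, map_zero, map_zero]

/-- The trace of `Iₘ`, `m = dim M(1)`, in `R_M ⊕ I_M` is `I_M`. -/
theorem map_incl_trace_I {m : ℕ} (hm : Module.finrank k M.V₁ = m) :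
    (trace (D.regularPart ⊔ D.preinjectivePart).toRep (I k m)).map
      (D.regularPart ⊔ D.preinjectivePart).incl = D.preinjectivePart := by
  rw [regularPart_sup_preinjectivePart]
  set N := D.part fun L => L.IsRegular ∨ L.IsPreinjective with hN
  apply SubRep.ext
  · refine (congrArg (Submodule.map N.S₁.subtype)
      (iSup_S₁ fun f : Hom (I k m) N.toRep => im f)).trans ((Submodule.map_iSup _ _).trans ?_)
    apply le_antisymm
    · refine iSup_le fun f => ?_
      rintro _ ⟨_, ⟨x, rfl⟩, rfl⟩
      refine (D.mem_part_S₁ Label.IsPreinjective _).2 fun i hi => ?_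
      -- A regular component dies because no nonzero morphism from `I k m` reaches it; a
      -- preprojective one is already zero in `N`.
      by_cases hr : i.1.1.IsRegular
      · exact (hom_I_eq_zero hr.injective (compHom (D.proj i) (compHom N.incl f))).1 x
      · exact (D.mem_part_S₁ _ _).1 (f.1.1 x).2 i (not_or.2 ⟨hr, hi⟩)
    · intro x hx
      replace hx := (D.mem_part_S₁ Label.IsPreinjective x).1 hx
      rw [← D.sum_single_proj_fst x]
      refine sum_mem fun i _ => ?_
      by_cases hi : i.1.1.IsPreinjective
      -- The component at `i` is hit by the composite of a surjection from `I k m` onto the summand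
      -- with its embedding, which lands in `N`.
      · obtain ⟨q, hq, -⟩ := Label.exists_surjective_hom_rep hi (hm ▸ D.finrank_rep_V₁_le i)
        obtain ⟨z, hz⟩ := hq ((D.proj i).1.1 x)
        refine Submodule.mem_iSup_of_mem (codRestrictHom N (compHom (D.single i) q)
          (fun _ => D.single_mem_part_S₁ (Or.inr hi) _)
          (fun _ => D.single_mem_part_S₂ (Or.inr hi) _)) ⟨_, ⟨z, rfl⟩, ?_⟩
        rw [← hz]
        rfl
      · rw [hx i hi, map_zero]
        exact zero_mem _
  · refine (congrArg (Submodule.map N.S₂.subtype)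
      (iSup_S₂ fun f : Hom (I k m) N.toRep => im f)).trans ((Submodule.map_iSup _ _).trans ?_)
    apply le_antisymm
    · refine iSup_le fun f => ?_
      rintro _ ⟨_, ⟨x, rfl⟩, rfl⟩
      refine (D.mem_part_S₂ Label.IsPreinjective _).2 fun i hi => ?_
      by_cases hr : i.1.1.IsRegular
      · exact (hom_I_eq_zero hr.injective (compHom (D.proj i) (compHom N.incl f))).2 x
      · exact (D.mem_part_S₂ _ _).1 (f.1.2 x).2 i (not_or.2 ⟨hr, hi⟩)
    · intro x hx
      replace hx := (D.mem_part_S₂ Label.IsPreinjective x).1 hx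
      rw [← D.sum_single_proj_snd x]
      refine sum_mem fun i _ => ?_
      by_cases hi : i.1.1.IsPreinjective
      · obtain ⟨q, -, hq⟩ := Label.exists_surjective_hom_rep hi (hm ▸ D.finrank_rep_V₁_le i)
        obtain ⟨z, hz⟩ := hq ((D.proj i).1.2 x)
        refine Submodule.mem_iSup_of_mem (codRestrictHom N (compHom (D.single i) q)
          (fun _ => D.single_mem_part_S₁ (Or.inr hi) _)
          (fun _ => D.single_mem_part_S₂ (Or.inr hi) _)) ⟨_, ⟨z, rfl⟩, ?_⟩
        rw [← hz]
        rfl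
      · rw [hx i hi, map_zero]
        exact zero_mem _

end Decomposition

/-! ### Quotient of a direct sum by one of its summands -/

section Quotient

/-- If `B` is the image of `T ≤ A ⊔ B` and `A`, `B` are disjoint, then `A` maps bijectively onto
`(A ⊔ B) ⧸ T`. -/
theorem bijective_mkQ_comp_inclusion {V : Type*} [AddCommGroup V] [Module k V]
    {A B : Submodule k V} (h : Disjoint A B) (T : Submodule k ↥(A ⊔ B))
    (hT : T.map (A ⊔ B).subtype = B) :
    Function.Bijective (T.mkQ ∘ₗ Submodule.inclusion (le_sup_left : A ≤ A ⊔ B)) := by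
  constructor
  · rw [injective_iff_map_eq_zero]
    intro a ha
    have ha' : Submodule.inclusion (le_sup_left : A ≤ A ⊔ B) a ∈ T :=
      (Submodule.Quotient.mk_eq_zero T).1 ha
    have hB : (a : V) ∈ B := hT ▸ ⟨_, ha', rfl⟩
    exact Subtype.ext (Submodule.disjoint_def.1 h a a.2 hB)
  · intro y
    obtain ⟨⟨z, hz⟩, rfl⟩ := T.mkQ_surjective y
    obtain ⟨a, ha, b, hb, rfl⟩ := Submodule.mem_sup.1 hz
    -- The class of `a + b` is that of `a`, since `b` comes from an element of `T`.
    refine ⟨⟨a, ha⟩, (Submodule.Quotient.eq T).2 ?_⟩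
    obtain ⟨t, ht, htb⟩ : b ∈ T.map (A ⊔ B).subtype := hT.symm ▸ hb
    convert T.neg_mem ht
    refine Subtype.ext ?_
    change a - (a + b) = -(A ⊔ B).subtype t
    rw [htb]
    abel

/-- If a subrepresentation `T` of a direct sum of subrepresentations `A`, `B` has image `B`, then
`A` is isomorphic to the quotient by `T`. -/
theorem nonempty_iso_quotient {M : KroneckerRep.{u, v} k} {A B : SubRep M}
    (h₁ : Disjoint A.S₁ B.S₁) (h₂ : Disjoint A.S₂ B.S₂) (T : SubRep (A ⊔ B).toRep)
    (hT : T.map (A ⊔ B).incl = B) : Nonempty (Iso A.toRep T.quotient) :=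
  ⟨{ e₁ := LinearEquiv.ofBijective _
        (bijective_mkQ_comp_inclusion h₁ T.S₁ (congrArg SubRep.S₁ hT))
     e₂ := LinearEquiv.ofBijective _
        (bijective_mkQ_comp_inclusion h₂ T.S₂ (congrArg SubRep.S₂ hT))
     comm_α := fun _ => rfl
     comm_β := fun _ => rfl }⟩

end Quotient

end KroneckerRep

theorem proposition5p3 {k : Type u} [Field k] [IsAlgClosed k] (M : KroneckerRep.{u, v} k)
    (D : KroneckerRep.Decomposition M) (d₁ d₂ : ℕ)
    (hd₁ : Module.finrank k M.V₁ = d₁) (hd₂ : Module.finrank k M.V₂ = d₂) :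
    (KroneckerRep.trace (D.regularPart ⊔ D.preinjectivePart).toRep (KroneckerRep.I k d₁)).map
        (D.regularPart ⊔ D.preinjectivePart).incl = D.preinjectivePart ∧
    (∀ (b : ℕ) (g : Module.Basis (Fin b) k (KroneckerRep.Hom (KroneckerRep.I k d₁)
          (D.regularPart ⊔ D.preinjectivePart).toRep)),
      (⨆ i, KroneckerRep.im (g i)) = KroneckerRep.trace
          (D.regularPart ⊔ D.preinjectivePart).toRep (KroneckerRep.I k d₁) ∧
      (⨆ i, KroneckerRep.im (g i)).map (D.regularPart ⊔ D.preinjectivePart).incl =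
        D.preinjectivePart) ∧
    (∀ (a b : ℕ) (f : Module.Basis (Fin a) k (KroneckerRep.Hom M (KroneckerRep.P k d₂)))
        (g : Module.Basis (Fin b) k (KroneckerRep.Hom (KroneckerRep.I k d₁)
          (⨅ i, KroneckerRep.ker (f i)).toRep)),
      Nonempty (KroneckerRep.Iso D.regularPart.toRep
        (⨆ i, KroneckerRep.im (g i)).quotient)) := by
  have htr := D.map_incl_trace_I hd₁
  refine ⟨htr, fun b g => ⟨KroneckerRep.iSup_im_basis g, ?_⟩, fun a b f => ?_⟩
  · rw [KroneckerRep.iSup_im_basis g]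
    exact htr
  · have hK := (KroneckerRep.iInf_ker_basis f).trans (D.iInf_ker_hom_P hd₂)
    -- The type of `g` depends on the common kernel, so the kernel is made a variable and
    -- substituted before `g` is introduced.
    generalize (⨅ i, KroneckerRep.ker (f i)) = K at hK ⊢
    subst hK
    intro g
    rw [KroneckerRep.iSup_im_basis g]
    have hdisj : ∀ L : KroneckerRep.Label k, L.IsRegular → ¬L.IsPreinjective := by
      intro L
      cases L <;> simp [KroneckerRep.Label.IsRegular, KroneckerRep.Label.IsPreinjective]
    exact KroneckerRep.nonempty_iso_quotient (D.disjoint_part_S₁ hdisj)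
      (D.disjoint_part_S₂ hdisj) _ htr
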